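/- Write $\log^{(0)}x=x$ and $\log^{(i+1)}x=\log_2(\log^{(i)}x)$. A $k$-round coin-flipping protocol over $\ell$ players with message lengths $r_1,\dots,r_k\in\mathbb{N}$ is a function $\pi:\prod_{i=1}^{k}(\{0,1\}^{r_i})^{\ell}\to\{0,1\}$: in round $i$ every player broadcasts an $r_i$-bit message, and $\pi$ maps the full transcript to the outcome. $\Pr[\pi=1]$ is the probability of outcome $1$ when all messages are independent and uniformly random. For a set $B\subseteq[\ell]$ of bad players, a strategy of $B$ chooses, in every round $i$, the round-$i$ messages of the players in $B$ as a function of the complete transcript of rounds $1,\dots,i-1$ and of the round-$i$ messages of the players outside $B$; the players outside $B$ still send independent uniformly random messages. We write $\Pr[\pi|_B=1]\ge q$ if some strategy of $B$ makes the outcome equal to $1$ with probability at least $q$. **Theorem.** There is an absolute constant $C>0$ such that the following holds for all integers $k\ge 1$ and $\ell$ for which $\log^{(k)}\ell$ is defined and at least $C$ (equivalently, $\log^{(i)}\ell\ge C$ for all $0\le i\le k$); in particular, for every fixed $k$, it holds for all sufficiently large $\ell$. Let $\pi$ be a $k$-round coin-flipping protocol over $\ell$ players in which each player sends $r_i\le(\log^{(i)}\ell)^{0.99}$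 bits in round $i$, for $i=1,\dots,k$, and suppose that $\Pr[\pi=1]\ge 0.01$. Then there is a set of bad players $B\subseteq[\ell]$ with $|B|\le 0.01\,\ell$ such that $\Pr[\pi|_B=1]\ge 0.99$. -/

import Mathlib

namespace CoinFlip

/-- The `i`-fold iterated binary logarithm `log^{(i)} x`, with `log^{(0)} x = x`.  It is the usual
notion as long as the preceding iterates `log^{(0)} x, …, log^{(i-1)} x` are positive. -/
noncomputable def iterLog (i : ℕ) (x : ℝ) : ℝ := (Real.logb 2)^[i] x

/-- `Pr[f = 1]` under the uniform distribution on the finite sample space `Ω`. -/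
noncomputable def prob {Ω : Type} [Fintype Ω] (f : Ω → Bool) : ℝ :=
  ((Finset.univ.filter fun ω => f ω = true).card : ℝ) / (Fintype.card Ω : ℝ)

/-- A message of `m` bits. -/
abbrev Msg (m : ℕ) : Type := Fin m → Bool

/-- The full transcript of `k` rounds over `ℓ` players, each of whom sends `r i` bits in
round `i`. -/
abbrev Transcript (ℓ k : ℕ) (r : Fin k → ℕ) : Type := (i : Fin k) → Fin ℓ → Msg (r i)

/-- A `k`-round coin-flipping protocol over `ℓ` players with `r i`-bit messages in round `i`:
honest players broadcast uniformly random bits, and the outcome of the protocol is a function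
of the transcript. -/
abbrev Protocol (ℓ k : ℕ) (r : Fin k → ℕ) : Type := Transcript ℓ k r → Bool

/-- The random bits of the good players (those outside `B`), over all rounds. -/
abbrev GoodCoins (ℓ k : ℕ) (r : Fin k → ℕ) (B : Finset (Fin ℓ)) : Type :=
  (i : Fin k) → {p : Fin ℓ // p ∉ B} → Msg (r i)

/-- A strategy of the bad players `B`.  In round `i` they know the complete transcript of the
previous rounds and the messages which the good players send in round `i`, and jointly choose
their own messages of round `i` (a full-information, rushing adversary). -/
abbrev Adversary (ℓ k : ℕ) (r : Fin k → ℕ) (B : Finset (Fin ℓ)) : Type :=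
  (i : Fin k) → ((j : Fin k) → j < i → Fin ℓ → Msg (r j)) →
    ({p : Fin ℓ // p ∉ B} → Msg (r i)) → ({p : Fin ℓ // p ∈ B} → Msg (r i))

/-- The transcript that results when the good players send `x` and the bad players `B` follow
the strategy `σ`. -/
def play {ℓ k : ℕ} {r : Fin k → ℕ} {B : Finset (Fin ℓ)} (σ : Adversary ℓ k r B)
    (x : GoodCoins ℓ k r B) (i : Fin k) : Fin ℓ → Msg (r i) := fun p =>
  if h : p ∈ B then σ i (fun j _ => play σ x j) (x i) ⟨p, h⟩ else x i ⟨p, h⟩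
termination_by i.val

end CoinFlip

namespace CoinFlip

open Finset
open scoped BigOperators

section Cube

variable {ι : Type*} [DecidableEq ι]

/-- The discrete derivative in the coordinate `j`. -/
def coordDiff (j : ι) (f : (ι → Bool) → ℝ) (x : ι → Bool) : ℝ :=
  f (Function.update x j true) - f (Function.update x j false)

/-- The average over the coordinate `j`. -/
noncomputable def coordMean (j : ι) (f : (ι → Bool) → ℝ) (x : ι → Bool) : ℝ :=
  (f (Function.update x j true) + f (Function.update x j false)) / 2

lemma coordDiff_self_coordMean (j : ι) (f : (ι → Bool) → ℝ) :
    coordDiff j (coordMean j f) = 0 := by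
  ext x; simp [coordDiff, coordMean]

lemma coordDiff_self_coordDiff (j : ι) (f : (ι → Bool) → ℝ) :
    coordDiff j (coordDiff j f) = 0 := by
  ext x; simp [coordDiff]

lemma coordDiff_coordMean_comm {i j : ι} (h : i ≠ j) (f : (ι → Bool) → ℝ) :
    coordDiff i (coordMean j f) = coordMean j (coordDiff i f) := by
  ext x
  simp only [coordDiff, coordMean, Function.update_comm h]
  ring

lemma coordDiff_comm {i j : ι} (h : i ≠ j) (f : (ι → Bool) → ℝ) :
    coordDiff i (coordDiff j f) = coordDiff j (coordDiff i f) := by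
  ext x
  simp only [coordDiff, Function.update_comm h]
  ring

lemma piecewise_update_right {S : Finset ι} {j : ι} (hj : j ∉ S) (y x : ι → Bool) (b : Bool) :
    S.piecewise y (Function.update x j b) = Function.update (S.piecewise y x) j b := by
  ext i
  by_cases h : i = j
  · subst h; simp [hj]
  · by_cases hi : i ∈ S <;> simp [hi, h]

lemma piecewise_update_left {S : Finset ι} {j : ι} (hj : j ∉ S) (y x : ι → Bool) (b : Bool) :
    S.piecewise (Function.update y j b) x = S.piecewise y x := by
  ext i
  by_cases h : i = j
  · subst h; simp [hj]
  · by_cases hi : i ∈ S <;> simp [hi, h]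

lemma coordDiff_sq_eq_abs {f : (ι → Bool) → ℝ} (hf : ∀ x, f x = 0 ∨ f x = 1) (i : ι)
    (x : ι → Bool) : coordDiff i f x ^ 2 = |coordDiff i f x| := by
  unfold coordDiff
  rcases hf (Function.update x i true) with h | h <;>
    rcases hf (Function.update x i false) with h' | h' <;> simp [h, h']

variable [Fintype ι]

/-- The average over the coordinates in `S`. -/
noncomputable def coordAvg (S : Finset ι) (f : (ι → Bool) → ℝ) (x : ι → Bool) : ℝ :=
  𝔼 y : ι → Bool, f (S.piecewise y x)

/-- The total influence in its quadratic form. -/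
noncomputable def energy (f : (ι → Bool) → ℝ) : ℝ :=
  ∑ i, 𝔼 x, coordDiff i f x ^ 2

lemma energy_nonneg (f : (ι → Bool) → ℝ) : 0 ≤ energy f :=
  Finset.sum_nonneg fun _ _ => Finset.expect_nonneg fun _ _ => sq_nonneg _

lemma expect_coordMean (j : ι) (f : (ι → Bool) → ℝ) :
    𝔼 x, coordMean j f x = 𝔼 x, f x := by
  have hinv : Function.Involutive (fun x : ι → Bool => Function.update x j (!x j)) := by
    intro x; ext i; by_cases h : i = j
    · subst h; simp
    · simp [h]
  have h1 : 𝔼 x, f (Function.update x j (!x j)) = 𝔼 x, f x :=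
    Fintype.expect_equiv hinv.toPerm _ _ fun x => rfl
  have h2 : ∀ x, coordMean j f x = (f x + f (Function.update x j (!x j))) / 2 := by
    intro x
    rcases hx : x j with _ | _
    · have : Function.update x j false = x := by rw [← hx]; simp
      simp [coordMean, this]; ring
    · have : Function.update x j true = x := by rw [← hx]; simp
      simp [coordMean, this]
  simp_rw [h2, ← Finset.expect_div, Finset.expect_add_distrib, h1]
  ring

lemma coordAvg_empty (f : (ι → Bool) → ℝ) : coordAvg ∅ f = f := by
  ext x; simp [coordAvg]

lemma coordAvg_univ (f : (ι → Bool) → ℝ) (x : ι → Bool) : coordAvg univ f x = 𝔼 y, f y := by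
  simp [coordAvg]

lemma coordAvg_insert {S : Finset ι} {j : ι} (hj : j ∉ S) (f : (ι → Bool) → ℝ) :
    coordAvg (insert j S) f = coordMean j (coordAvg S f) := by
  ext x
  have h := expect_coordMean j (fun y => f ((insert j S).piecewise y x))
  rw [coordAvg, ← h]
  simp only [coordMean, coordAvg, Finset.piecewise_insert, Function.update_self,
    piecewise_update_left hj, piecewise_update_right hj]
  rw [← Finset.expect_div, Finset.expect_add_distrib]

lemma coordDiff_coordAvg {S : Finset ι} {i : ι} (hi : i ∉ S) (f : (ι → Bool) → ℝ) :
    coordDiff i (coordAvg S f) = coordAvg S (coordDiff i f) := by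
  ext x
  simp only [coordDiff, coordAvg, piecewise_update_right hi, Finset.expect_sub_distrib]

lemma expect_coordAvg (S : Finset ι) (f : (ι → Bool) → ℝ) :
    𝔼 x, coordAvg S f x = 𝔼 x, f x := by
  induction S using Finset.induction_on with
  | empty => rw [coordAvg_empty]
  | insert j S hj ih => rw [coordAvg_insert hj, expect_coordMean, ih]

lemma expect_sq_eq (j : ι) (f : (ι → Bool) → ℝ) :
    𝔼 x, f x ^ 2 = 𝔼 x, coordMean j f x ^ 2 + (𝔼 x, coordDiff j f x ^ 2) / 4 := by
  rw [← expect_coordMean j (fun x => f x ^ 2), Finset.expect_div, ← Finset.expect_add_distrib]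
  refine Finset.expect_congr rfl fun x _ => ?_
  simp only [coordMean, coordDiff]
  ring

lemma energy_coordMean_add_le (j : ι) (f : (ι → Bool) → ℝ) :
    energy (coordMean j f) + energy (coordDiff j f) / 4 ≤ energy f := by
  unfold energy
  rw [Finset.sum_div, ← Finset.sum_add_distrib]
  refine Finset.sum_le_sum fun i _ => ?_
  by_cases h : i = j
  · subst h
    rw [coordDiff_self_coordMean, coordDiff_self_coordDiff]
    simpa using Finset.expect_nonneg fun x _ => sq_nonneg (coordDiff i f x)
  · rw [expect_sq_eq j (coordDiff i f), coordDiff_coordMean_comm h, coordDiff_comm h]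

/-- The two-point logarithmic Sobolev inequality. -/
lemma two_point_entropy_le {u v : ℝ} (hu : 0 ≤ u) (hv : 0 ≤ v) :
    (u * Real.log u + v * Real.log v) / 2 ≤
      (u + v) / 2 * Real.log ((u + v) / 2) + (√u - √v) ^ 2 := by
  rcases (add_nonneg hu hv).eq_or_lt with h0 | h0
  · obtain rfl : u = 0 := by linarith
    obtain rfl : v = 0 := by linarith
    simp
  have key : ∀ t M : ℝ, 0 ≤ t → 0 < M → t * Real.log t ≤ t * Real.log M + t * (t / M - 1) := by
    intro t M ht hM
    rcases ht.eq_or_lt with rfl | ht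
    · simp
    have := Real.log_le_sub_one_of_pos (div_pos ht hM)
    rw [Real.log_div ht.ne' hM.ne'] at this
    nlinarith
  have hM : 0 < (u + v) / 2 := by linarith
  have k1 := key u _ hu hM
  have k2 := key v _ hv hM
  have hs : (√u - √v) ^ 2 ≥ (u - v) ^ 2 / (2 * (u + v)) := by
    rw [ge_iff_le, div_le_iff₀ (by linarith)]
    have e1 := Real.sq_sqrt hu
    have e2 := Real.sq_sqrt hv
    set a := √u
    set b := √v
    rw [← e1, ← e2]
    nlinarith [sq_nonneg ((a - b) ^ 2)]
  have he : (u * (u / ((u + v) / 2) - 1) + v * (v / ((u + v) / 2) - 1)) / 2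
      = (u - v) ^ 2 / (2 * (u + v)) := by
    field_simp; ring
  linarith

lemma sq_sqrt_coordAvg_sub_le {S : Finset ι} (f g : (ι → Bool) → ℝ) (x : ι → Bool) :
    (√(coordAvg S (fun y => f y ^ 2) x) - √(coordAvg S (fun y => g y ^ 2) x)) ^ 2 ≤
      coordAvg S (fun y => (f y - g y) ^ 2) x := by
  have hf : 0 ≤ coordAvg S (fun y => f y ^ 2) x := Finset.expect_nonneg fun _ _ => sq_nonneg _
  have hg : 0 ≤ coordAvg S (fun y => g y ^ 2) x := Finset.expect_nonneg fun _ _ => sq_nonneg _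
  have cs : coordAvg S (fun y => f y * g y) x ≤
      √(coordAvg S (fun y => f y ^ 2) x) * √(coordAvg S (fun y => g y ^ 2) x) := by
    rw [← Real.sqrt_mul hf]
    apply Real.le_sqrt_of_sq_le
    simpa [coordAvg] using expect_mul_sq_le_sq_mul_sq univ
      (fun y => f (S.piecewise y x)) (fun y => g (S.piecewise y x))
  have hexp : coordAvg S (fun y => (f y - g y) ^ 2) x = coordAvg S (fun y => f y ^ 2) x
      + coordAvg S (fun y => g y ^ 2) x - 2 * coordAvg S (fun y => f y * g y) x := by
    simp only [coordAvg, Finset.mul_expect, ← Finset.expect_add_distrib,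
      ← Finset.expect_sub_distrib]
    exact Finset.expect_congr rfl fun _ _ => by ring
  rw [hexp, sub_sq, Real.sq_sqrt hf, Real.sq_sqrt hg]
  linarith

lemma expect_entropy_coordAvg_le (S : Finset ι) (g : (ι → Bool) → ℝ) :
    𝔼 x, g x ^ 2 * Real.log (g x ^ 2) ≤
      𝔼 x, coordAvg S (fun y => g y ^ 2) x * Real.log (coordAvg S (fun y => g y ^ 2) x)
        + ∑ i ∈ S, 𝔼 x, coordDiff i g x ^ 2 := by
  induction S using Finset.induction_on with
  | empty => simp [coordAvg_empty]
  | insert j S hj ih =>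
    rw [Finset.sum_insert hj]
    refine ih.trans ?_
    suffices h : 𝔼 x, coordAvg S (fun y => g y ^ 2) x * Real.log (coordAvg S (fun y => g y ^ 2) x)
        ≤ 𝔼 x, coordAvg (insert j S) (fun y => g y ^ 2) x *
            Real.log (coordAvg (insert j S) (fun y => g y ^ 2) x)
          + 𝔼 x, coordDiff j g x ^ 2 by linarith
    rw [← expect_coordAvg S (fun x => coordDiff j g x ^ 2), ← Finset.expect_add_distrib,
      ← expect_coordMean j]
    refine Finset.expect_le_expect fun x _ => ?_
    rw [coordAvg_insert hj]
    have hnn : ∀ x, 0 ≤ coordAvg S (fun y => g y ^ 2) x := fun x =>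
      Finset.expect_nonneg fun _ _ => sq_nonneg _
    refine (two_point_entropy_le (hnn _) (hnn _)).trans ?_
    simp only [coordMean]
    gcongr
    have := sq_sqrt_coordAvg_sub_le (S := S) (fun y => g (Function.update y j true))
      (fun y => g (Function.update y j false)) x
    simpa [coordAvg, coordDiff, piecewise_update_right hj] using this

/-- The logarithmic Sobolev inequality on the cube. -/
lemma log_sobolev (g : (ι → Bool) → ℝ) :
    𝔼 x, g x ^ 2 * Real.log (g x ^ 2) ≤
      (𝔼 x, g x ^ 2) * Real.log (𝔼 x, g x ^ 2) + energy g := by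
  simpa [coordAvg_univ, energy] using expect_entropy_coordAvg_le univ g

/-- A lower bound for the entropy of `h²` in terms of the first two moments of `|h|`. -/
lemma entropy_sq_ge {Ω : Type*} [Fintype Ω] [Nonempty Ω] (h : Ω → ℝ) {A : ℝ} (hA : 0 < A) :
    (1 + Real.log A) * 𝔼 x, h x ^ 2 - A * (𝔼 x, |h x|) ^ 2 ≤
      𝔼 x, h x ^ 2 * Real.log (h x ^ 2) - (𝔼 x, h x ^ 2) * Real.log (𝔼 x, h x ^ 2) := by
  set w := 𝔼 x, h x ^ 2 with hw
  set m := 𝔼 x, |h x| with hm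
  have hw0 : 0 ≤ w := Finset.expect_nonneg fun _ _ => sq_nonneg _
  rcases hw0.eq_or_lt with h0 | hpos
  · have hz : ∀ x, h x = 0 := by
      intro x
      have := (Finset.expect_eq_zero_iff_of_nonneg (s := univ)
        (fun x _ => sq_nonneg (h x))).1 h0.symm x (mem_univ x)
      exact pow_eq_zero_iff (two_ne_zero) |>.1 this
    simp [hm, ← h0, hz]
  set a := √(A * w) with ha
  have hapos : 0 < a := Real.sqrt_pos.2 (by positivity)
  have ha2 : a ^ 2 = A * w := Real.sq_sqrt (by positivity)
  have pt : ∀ x, 2 * h x ^ 2 - 2 * a * |h x| + h x ^ 2 * Real.log (a ^ 2) ≤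
      h x ^ 2 * Real.log (h x ^ 2) := by
    intro x
    rcases eq_or_ne (h x) 0 with hx | hx
    · simp [hx]
    have hx' : 0 < |h x| := abs_pos.2 hx
    have := Real.log_le_sub_one_of_pos (div_pos hapos hx')
    rw [Real.log_div hapos.ne' hx'.ne'] at this
    rw [← sq_abs (h x), Real.log_pow, Real.log_pow]
    push_cast
    have e : |h x| ^ 2 * (a / |h x|) = a * |h x| := by field_simp
    nlinarith [mul_le_mul_of_nonneg_left this (sq_nonneg |h x|)]
  have hsum : 2 * w - 2 * a * m + w * Real.log (a ^ 2) ≤ 𝔼 x, h x ^ 2 * Real.log (h x ^ 2) := by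
    have := Finset.expect_le_expect (s := univ) fun x _ => pt x
    rwa [Finset.expect_add_distrib, Finset.expect_sub_distrib, ← Finset.mul_expect,
      ← Finset.mul_expect, ← Finset.expect_mul] at this
  rw [ha2, Real.log_mul hA.ne' hpos.ne'] at hsum
  have amgm : 2 * a * m ≤ w + A * m ^ 2 := by
    have e : a = √A * √w := Real.sqrt_mul hA.le _
    have e1 := Real.sq_sqrt hA.le
    have e2 := Real.sq_sqrt hw0
    rw [e]
    nlinarith [sq_nonneg (√w - √A * m)]
  linarith

lemma expect_abs_coordAvg_le (S : Finset ι) (f : (ι → Bool) → ℝ) :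
    𝔼 x, |coordAvg S f x| ≤ 𝔼 x, |f x| := by
  rw [← expect_coordAvg S (fun x => |f x|)]
  exact Finset.expect_le_expect fun x _ => Finset.abs_expect_le _ _

lemma variance_mul_log_le_aux (f : (ι → Bool) → ℝ) (S : Finset ι) {A : ℝ} (hA : 0 < A) :
    (1 + Real.log A) * (𝔼 x, f x ^ 2 - 𝔼 x, coordAvg S f x ^ 2) + energy (coordAvg S f) ≤
      energy f + A / 4 * ∑ j ∈ S, (𝔼 x, |coordDiff j f x|) ^ 2 := by
  induction S using Finset.induction_on with
  | empty => simp [coordAvg_empty]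
  | insert j S hj ih =>
    rw [Finset.sum_insert hj, coordAvg_insert hj]
    have e1 := energy_coordMean_add_le j (coordAvg S f)
    have e2 := expect_sq_eq j (coordAvg S f)
    have e3 := log_sobolev (coordDiff j (coordAvg S f))
    have e4 := entropy_sq_ge (coordDiff j (coordAvg S f)) hA
    have e5 : (𝔼 x, |coordDiff j (coordAvg S f) x|) ^ 2 ≤ (𝔼 x, |coordDiff j f x|) ^ 2 := by
      rw [coordDiff_coordAvg hj]
      exact pow_le_pow_left₀ (Finset.expect_nonneg fun _ _ => abs_nonneg _)
        (expect_abs_coordAvg_le S _) 2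
    rw [e2] at ih
    nlinarith [mul_le_mul_of_nonneg_left e5 hA.le]

/-- The Falik–Samorodnitsky inequality: the variance that is not explained by the coordinates
outside `S` is small when the coordinates in `S` have small influences. -/
lemma variance_mul_log_le (f : (ι → Bool) → ℝ) (S : Finset ι) {A : ℝ} (hA : 0 < A) :
    (1 + Real.log A) * (𝔼 x, f x ^ 2 - 𝔼 x, coordAvg S f x ^ 2) ≤
      energy f + A / 4 * ∑ j ∈ S, (𝔼 x, |coordDiff j f x|) ^ 2 := by
  have := variance_mul_log_le_aux f S hA
  linarith [energy_nonneg (coordAvg S f)]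

/-- A Boolean function of small total influence becomes nearly constantly `1` after few
coordinates are fixed suitably. -/
lemma exists_small_fixing {f : (ι → Bool) → ℝ} (hf : ∀ x, f x = 0 ∨ f x = 1) {K ε : ℝ}
    (hK : 0 < K) (hε : 0 < ε) (hpos : 0 < 𝔼 x, f x) (hE : energy f ≤ K * 𝔼 x, f x) :
    ∃ J : Finset ι, (J.card : ℝ) ≤ K * Real.exp (2 * K / ε) ∧
      ∃ x : ι → Bool, 1 - ε ≤ 𝔼 y, f (J.piecewise x y) := by
  set p := 𝔼 x, f x with hp
  set τ := Real.exp (-(2 * K / ε)) with hτ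
  have hτ0 : 0 < τ := Real.exp_pos _
  have hI : energy f = ∑ i, 𝔼 x, |coordDiff i f x| := by
    unfold energy
    exact Finset.sum_congr rfl fun i _ => Finset.expect_congr rfl fun x _ =>
      coordDiff_sq_eq_abs hf i x
  have hInn : ∀ i, 0 ≤ 𝔼 x, |coordDiff i f x| := fun i =>
    Finset.expect_nonneg fun _ _ => abs_nonneg _
  have hp1 : p ≤ 1 := Finset.expect_le univ_nonempty fun x _ => by
    rcases hf x with h | h <;> simp [h]
  set J : Finset ι := univ.filter fun i => τ < 𝔼 x, |coordDiff i f x| with hJ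
  refine ⟨J, ?_, ?_⟩
  · have h1 : (J.card : ℝ) * τ ≤ ∑ i ∈ J, 𝔼 x, |coordDiff i f x| := by
      rw [← nsmul_eq_mul]
      exact Finset.card_nsmul_le_sum _ _ _ fun i hi => (Finset.mem_filter.1 hi).2.le
    have h2 : ∑ i ∈ J, 𝔼 x, |coordDiff i f x| ≤ energy f := by
      rw [hI]
      exact Finset.sum_le_sum_of_subset_of_nonneg (Finset.subset_univ _) fun i _ _ => hInn i
    have h3 : (J.card : ℝ) * τ ≤ K := by nlinarith
    have h4 : Real.exp (2 * K / ε) = τ⁻¹ := by rw [hτ, Real.exp_neg, inv_inv]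
    rw [h4, ← div_eq_mul_inv, le_div_iff₀ hτ0]
    exact h3
  · by_contra! hcon
    have hcon' : ∀ x, coordAvg Jᶜ f x < 1 - ε := by
      intro x
      have := hcon x
      simpa [coordAvg, Finset.piecewise_compl] using this
    have hnn : ∀ x, 0 ≤ coordAvg Jᶜ f x := fun x => Finset.expect_nonneg fun y _ => by
      rcases hf (Jᶜ.piecewise y x) with h | h <;> simp [h]
    have hsq : 𝔼 x, f x ^ 2 = p := Finset.expect_congr rfl fun x _ => by
      rcases hf x with h | h <;> simp [h]
    have hA2 : 𝔼 x, coordAvg Jᶜ f x ^ 2 ≤ (1 - ε) * p := by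
      rw [hp, ← expect_coordAvg Jᶜ f, Finset.mul_expect]
      refine Finset.expect_le_expect fun x _ => ?_
      nlinarith [hcon' x, hnn x]
    have hsum : ∑ j ∈ Jᶜ, (𝔼 x, |coordDiff j f x|) ^ 2 ≤ τ * energy f := by
      rw [hI, Finset.mul_sum]
      refine (Finset.sum_le_sum fun j hj => ?_).trans
        (Finset.sum_le_sum_of_subset_of_nonneg (Finset.subset_univ Jᶜ)
          fun i _ _ => mul_nonneg hτ0.le (hInn i))
      have : 𝔼 x, |coordDiff j f x| ≤ τ := by simpa [hJ] using hj
      nlinarith [hInn j]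
    have main := variance_mul_log_le f Jᶜ (A := τ⁻¹) (by positivity)
    rw [hsq, Real.log_inv, hτ, Real.log_exp, neg_neg, ← hτ] at main
    have h5 : τ⁻¹ / 4 * ∑ j ∈ Jᶜ, (𝔼 x, |coordDiff j f x|) ^ 2 ≤ energy f / 4 := by
      calc _ ≤ τ⁻¹ / 4 * (τ * energy f) := by gcongr
        _ = _ := by field_simp
    have h6 : (1 + 2 * K / ε) * (ε * p) ≤ (1 + 2 * K / ε) * (p - 𝔼 x, coordAvg Jᶜ f x ^ 2) := by
      have : 0 ≤ 1 + 2 * K / ε := by positivity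
      exact mul_le_mul_of_nonneg_left (by linarith) this
    have h7 : (1 + 2 * K / ε) * (ε * p) = ε * p + 2 * (K * p) := by field_simp
    nlinarith [mul_pos hε hpos, mul_pos hK hpos]

end Cube

section Control

variable {P α : Type*} [DecidableEq P]

/-- The best value of `f` that the players in `B` can reach when the others play according
to `x`. -/
noncomputable def control (B : Finset P) (f : (P → α) → ℝ) (x : P → α) : ℝ :=
  ⨆ y : P → α, f (B.piecewise y x)

lemma piecewise_union_eq (B B' : Finset P) (y y' x : P → α) :
    B'.piecewise y' (B.piecewise y x) = (B ∪ B').piecewise (B'.piecewise y' y) x := by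
  ext p
  by_cases h : p ∈ B <;> by_cases h' : p ∈ B' <;> simp [h, h']

variable [Finite P] [Finite α]

lemma le_control (B : Finset P) (f : (P → α) → ℝ) (x y : P → α) :
    f (B.piecewise y x) ≤ control B f x :=
  le_ciSup (f := fun y => f (B.piecewise y x)) (Set.finite_range _).bddAbove y

lemma self_le_control (B : Finset P) (f : (P → α) → ℝ) (x : P → α) : f x ≤ control B f x := by
  have h : B.piecewise x x = x := by ext p; simp [Finset.piecewise]
  exact (congrArg f h).ge.trans (le_control B f x x)

variable [Nonempty α]

lemma exists_control_eq (B : Finset P) (f : (P → α) → ℝ) (x : P → α) :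
    ∃ y, f (B.piecewise y x) = control B f x :=
  exists_eq_ciSup_of_finite (f := fun y => f (B.piecewise y x))

lemma control_control_le (B B' : Finset P) (f : (P → α) → ℝ) (x : P → α) :
    control B (control B' f) x ≤ control (B ∪ B') f x := by
  obtain ⟨y, hy⟩ := exists_control_eq B (control B' f) x
  obtain ⟨y', hy'⟩ := exists_control_eq B' f (B.piecewise y x)
  rw [← hy, ← hy', piecewise_union_eq]
  exact le_control _ _ _ _

lemma control_mono {f g : (P → α) → ℝ} (h : ∀ x, f x ≤ g x) (B : Finset P) (x : P → α) :
    control B f x ≤ control B g x := by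
  obtain ⟨y, hy⟩ := exists_control_eq B f x
  rw [← hy]
  exact (h _).trans (le_control _ _ _ _)

lemma control_mono_set {B B' : Finset P} (h : B ⊆ B') (f : (P → α) → ℝ) (x : P → α) :
    control B f x ≤ control B' f x :=
  (control_mono (self_le_control B' f) B x).trans <| by
    simpa [Finset.union_eq_right.2 h] using control_control_le B B' f x

lemma control_eq_zero_or_one {f : (P → α) → ℝ} (hf : ∀ x, f x = 0 ∨ f x = 1) (B : Finset P)
    (x : P → α) : control B f x = 0 ∨ control B f x = 1 := by
  obtain ⟨y, hy⟩ := exists_control_eq B f x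
  rw [← hy]
  exact hf _

end Control

section Greedy

lemma image_cons_univ {P : Type*} [DecidableEq P] {N : ℕ} (p : P) (c : Fin N → P) :
    univ.image (Fin.cons (α := fun _ => P) p c) = insert p (univ.image c) := by
  rw [Fin.univ_succ, Finset.cons_eq_insert, Finset.image_insert, Fin.cons_zero, Finset.map_eq_image,
    Finset.image_image]
  rfl

variable {P α : Type*} [DecidableEq P] [Fintype P] [Fintype α] [Nonempty α]

/-- Adding random players one at a time either raises the mean geometrically or reaches a
function on which the monotone functional `Φ` is at least `q`. -/
lemma le_expect_control_sequence [Nonempty P] {Φ : ((P → α) → ℝ) → ℝ} (hΦ0 : ∀ g, 0 ≤ Φ g)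
    (hΦ : ∀ g g', (∀ x, g x ≤ g' x) → Φ g ≤ Φ g') {q κ : ℝ} (hq : 0 ≤ q) (hκ : 0 ≤ κ)
    (hgain : ∀ g : (P → α) → ℝ, (∀ x, g x = 0 ∨ g x = 1) →
      q ≤ Φ g ∨ (1 + κ) * 𝔼 x, g x ≤ 𝔼 p, 𝔼 x, control {p} g x)
    (N : ℕ) (f : (P → α) → ℝ) (hf : ∀ x, f x = 0 ∨ f x = 1) :
    q * (𝔼 x, f x - ((1 + κ)⁻¹) ^ N) ≤ 𝔼 c : Fin N → P, Φ (control (univ.image c) f) := by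
  classical
  have hle1 : ∀ f : (P → α) → ℝ, (∀ x, f x = 0 ∨ f x = 1) → 𝔼 x, f x ≤ 1 := fun f hf =>
    Finset.expect_le univ_nonempty fun x _ => by rcases hf x with h | h <;> simp [h]
  have hρ : 0 < (1 + κ)⁻¹ := by positivity
  induction N generalizing f with
  | zero =>
    refine le_trans ?_ (Finset.expect_nonneg fun _ _ => hΦ0 _)
    have := hle1 f hf
    simp only [pow_zero]
    nlinarith
  | succ N ih =>
    rcases hgain f hf with h | h
    · refine le_trans ?_ (Finset.le_expect univ_nonempty fun c _ =>
        h.trans (hΦ _ _ (self_le_control _ f)))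
      have := hle1 f hf
      have h2 : 0 < ((1 + κ)⁻¹) ^ (N + 1) := by positivity
      nlinarith
    · have e1 : 𝔼 c : Fin (N + 1) → P, Φ (control (univ.image c) f) =
          𝔼 z : P × (Fin N → P), Φ (control (insert z.1 (univ.image z.2)) f) := by
        symm
        refine Fintype.expect_equiv (Fin.consEquiv fun _ => P) _ _ fun z => ?_
        have : univ.image (Fin.cons (α := fun _ => P) z.1 z.2) =
            insert z.1 (univ.image z.2) := image_cons_univ z.1 z.2
        exact congrArg (fun S => Φ (control S f)) this.symm
      have e2 : 𝔼 p, 𝔼 c : Fin N → P, Φ (control (univ.image c) (control {p} f)) ≤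
          𝔼 c : Fin (N + 1) → P, Φ (control (univ.image c) f) := by
        rw [e1, ← Finset.univ_product_univ, Finset.expect_product]
        refine Finset.expect_le_expect fun p _ => Finset.expect_le_expect fun c _ => hΦ _ _ ?_
        intro x
        have := control_control_le (univ.image c) {p} f x
        rwa [Finset.union_comm, ← Finset.insert_eq] at this
      refine le_trans ?_ e2
      have e3 : q * (𝔼 p, 𝔼 x, control {p} f x - ((1 + κ)⁻¹) ^ N) ≤
          𝔼 p, 𝔼 c : Fin N → P, Φ (control (univ.image c) (control {p} f)) := by
        have := Finset.expect_le_expect (s := univ) fun p _ =>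
          ih (control {p} f) (control_eq_zero_or_one hf {p})
        rwa [← Finset.mul_expect, Finset.expect_sub_distrib,
          Finset.expect_const univ_nonempty] at this
      by_cases h0 : 𝔼 x, f x ≤ ((1 + κ)⁻¹) ^ (N + 1)
      · refine le_trans ?_ (Finset.expect_nonneg fun _ _ => Finset.expect_nonneg fun _ _ => hΦ0 _)
        nlinarith
      · refine le_trans (mul_le_mul_of_nonneg_left ?_ hq) e3
        have e4 : (1 + κ) * ((1 + κ)⁻¹) ^ (N + 1) = ((1 + κ)⁻¹) ^ N := by
          rw [pow_succ]; field_simp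
        push Not at h0
        nlinarith

end Greedy

section Influence

variable {P : Type*} [DecidableEq P] [Fintype P] {r : ℕ}

lemma expect_curry (f : (P → Msg r) → ℝ) :
    𝔼 z : P × Fin r → Bool, f (Function.curry z) = 𝔼 x, f x :=
  Fintype.expect_equiv (Equiv.curry P (Fin r) Bool) _ _ fun _ => rfl

lemma energy_curry_le {f : (P → Msg r) → ℝ} (hf : ∀ x, f x = 0 ∨ f x = 1) :
    energy (fun z : P × Fin r → Bool => f (Function.curry z)) ≤
      2 * r * ∑ p, (𝔼 x, control {p} f x - 𝔼 x, f x) := by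
  have key : ∀ (p : P) (b : Fin r),
      𝔼 z, coordDiff (p, b) (fun z : P × Fin r → Bool => f (Function.curry z)) z ^ 2 ≤
        2 * (𝔼 x, control {p} f x - 𝔼 x, f x) := by
    intro p b
    rw [← expect_curry f, ← expect_curry (control {p} f),
      ← expect_coordMean (p, b) (fun z => f (Function.curry z)),
      ← Finset.expect_sub_distrib, Finset.mul_expect]
    refine Finset.expect_le_expect fun z _ => ?_
    rw [coordDiff_sq_eq_abs (fun z => hf _)]
    have hu : ∀ c, f (Function.curry (Function.update z (p, b) c)) ≤
        control {p} f (Function.curry z) := by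
      intro c
      refine le_trans (le_of_eq ?_)
        (le_control {p} f (Function.curry z) (Function.curry (Function.update z (p, b) c)))
      congr 1
      ext p' b'
      by_cases h : p' = p
      · subst h; simp
      · simp [h, Function.curry]
    have h1 := hu true
    have h2 := hu false
    simp only [coordDiff, coordMean]
    rcases abs_cases (f (Function.curry (Function.update z (p, b) true)) -
      f (Function.curry (Function.update z (p, b) false))) with h | h <;> linarith [h.1]
  unfold energy
  rw [Fintype.sum_prod_type, Finset.mul_sum]
  refine Finset.sum_le_sum fun p _ => ?_
  refine (Finset.sum_le_sum fun b _ => key p b).trans (le_of_eq ?_)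
  simp; ring

/-- Either few players can make `f` almost surely `1`, or a random player raises the mean. -/
lemma exists_coalition_or_gain [Nonempty P] {f : (P → Msg r) → ℝ}
    (hf : ∀ x, f x = 0 ∨ f x = 1) {K ε κ : ℝ} (hK : 0 < K) (hε : 0 < ε)
    (hκ : κ * (2 * r * Fintype.card P) ≤ K) :
    (∃ J : Finset P, (J.card : ℝ) ≤ K * Real.exp (2 * K / ε) ∧ 1 - ε ≤ 𝔼 x, control J f x) ∨
      (1 + κ) * 𝔼 x, f x ≤ 𝔼 p, 𝔼 x, control {p} f x := by
  have hu0 : 0 ≤ 𝔼 x, f x := Finset.expect_nonneg fun x _ => by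
    rcases hf x with h | h <;> simp [h]
  have hmono : 𝔼 x, f x ≤ 𝔼 p, 𝔼 x, control {p} f x :=
    Finset.le_expect univ_nonempty fun p _ => Finset.expect_le_expect fun x _ =>
      self_le_control {p} f x
  rcases hu0.eq_or_lt with h0 | hpos
  · right; rw [← h0] at hmono ⊢; simpa using hmono
  by_cases hE : energy (fun z : P × Fin r → Bool => f (Function.curry z)) ≤ K * 𝔼 x, f x
  · left
    obtain ⟨J, hJ, x, hx⟩ := exists_small_fixing
      (f := fun z : P × Fin r → Bool => f (Function.curry z)) (fun z => hf _) hK hε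
      (by rwa [expect_curry]) (by rwa [expect_curry])
    refine ⟨J.image Prod.fst, le_trans (by exact_mod_cast Finset.card_image_le) hJ, hx.trans ?_⟩
    rw [← expect_curry (control _ f)]
    refine Finset.expect_le_expect fun y _ => ?_
    refine le_trans (le_of_eq ?_) (le_control (J.image Prod.fst) f (Function.curry y)
      (Function.curry (J.piecewise x y)))
    congr 1
    ext p b
    by_cases h : p ∈ J.image Prod.fst
    · simp only [Finset.piecewise_eq_of_mem _ _ _ h]
    · have h' : (p, b) ∉ J := fun hm => h (Finset.mem_image_of_mem Prod.fst hm)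
      simp only [Finset.piecewise_eq_of_notMem _ _ _ h]
      simp [Function.curry, h']
  · right
    push Not at hE
    have h1 := energy_curry_le hf
    have hc : (0 : ℝ) < Fintype.card P := by exact_mod_cast Fintype.card_pos
    have h2 : ∑ p, (𝔼 x, control {p} f x - 𝔼 x, f x) =
        Fintype.card P * (𝔼 p, 𝔼 x, control {p} f x - 𝔼 x, f x) := by
      rw [Finset.sum_sub_distrib, Fintype.expect_eq_sum_div_card (fun p => 𝔼 x, control {p} f x)]
      simp only [Finset.sum_const, Finset.card_univ, nsmul_eq_mul]
      field_simp
    rw [h2] at h1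
    have h3 : κ * (2 * r * Fintype.card P) * 𝔼 x, f x <
        2 * r * Fintype.card P * (𝔼 p, 𝔼 x, control {p} f x - 𝔼 x, f x) := by
      have := mul_le_mul_of_nonneg_right hκ hpos.le
      linarith
    have h4 : (0 : ℝ) ≤ 2 * r * Fintype.card P := by positivity
    by_contra! hcon
    nlinarith

end Influence

section Blocks

lemma card_block_le (ℓ b j : ℕ) (hb : 0 < b) :
    (univ.filter fun p : Fin ℓ => (p : ℕ) / b = j).card ≤ b := by
  have : (univ.filter fun p : Fin ℓ => (p : ℕ) / b = j).card ≤ (Ico (j * b) (j * b + b)).card := by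
    refine Finset.card_le_card_of_injOn Fin.val (fun p hp => ?_) (Fin.val_injective.injOn)
    have h : (p : ℕ) / b = j := by simpa using hp
    have h1 := (Nat.div_eq_iff hb).1 h
    simp only [coe_Ico, Set.mem_Ico]
    omega
  simpa using this

/-- The union of the blocks of `b` consecutive players selected by `h`. -/
def blocks {ℓ : ℕ} (b : ℕ) {m Q : ℕ} (h : Fin m → Fin Q) : Finset (Fin ℓ) :=
  univ.biUnion fun a => univ.filter fun p : Fin ℓ => (p : ℕ) / b = h a

lemma card_blocks_le {ℓ b m Q : ℕ} (hb : 0 < b) (h : Fin m → Fin Q) :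
    (blocks b h : Finset (Fin ℓ)).card ≤ m * b := by
  refine Finset.card_biUnion_le.trans ?_
  refine (Finset.sum_le_sum fun a _ => card_block_le ℓ b (h a) hb).trans ?_
  simp

lemma exists_subset_blocks {ℓ b m : ℕ} (J : Finset (Fin ℓ)) (hJ : J.card ≤ m) :
    ∃ h : Fin m → Fin (ℓ / b + 1), J ⊆ blocks b h := by
  have hlt : ∀ p : Fin ℓ, (p : ℕ) / b < ℓ / b + 1 := fun p =>
    Nat.lt_succ_of_le (Nat.div_le_div_right p.2.le)
  refine ⟨fun a => if ha : (a : ℕ) < J.card then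
    ⟨(J.equivFin.symm ⟨a, ha⟩ : Fin ℓ) / b, hlt _⟩ else 0, fun p hp => ?_⟩
  simp only [blocks, mem_biUnion, mem_univ, true_and, mem_filter]
  have hi := (J.equivFin ⟨p, hp⟩).2
  refine ⟨⟨J.equivFin ⟨p, hp⟩, hi.trans_le hJ⟩, ?_⟩
  simp [hi]

/-- A distribution on small coalitions that, with a noticeable probability, control any given
one-round protocol whose mean is at least `δ`. -/
lemma one_round {ℓ r N m b : ℕ} (hℓ : 0 < ℓ) (hb : 0 < b) {K ε κ δ : ℝ} (hK : 0 < K)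
    (hε : 0 < ε) (hκ0 : 0 ≤ κ) (hκ : κ * (2 * r * ℓ) ≤ K) (hN : ((1 + κ)⁻¹) ^ N ≤ δ / 2)
    (hm : K * Real.exp (2 * K / ε) ≤ m) :
    ∃ (Ω : Type) (_ : Fintype Ω) (_ : Nonempty Ω) (B : Ω → Finset (Fin ℓ)),
      (∀ ω, (B ω).card ≤ N + m * b) ∧
      ∀ f : (Fin ℓ → Msg r) → ℝ, (∀ x, f x = 0 ∨ f x = 1) → δ ≤ 𝔼 x, f x →
        δ / 2 * (((ℓ / b + 1 : ℕ) : ℝ) ^ m)⁻¹ ≤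
          𝔼 ω, if 1 - ε ≤ 𝔼 x, control (B ω) f x then (1 : ℝ) else 0 := by
  have : Nonempty (Fin ℓ) := ⟨⟨0, hℓ⟩⟩
  refine ⟨(Fin N → Fin ℓ) × (Fin m → Fin (ℓ / b + 1)), inferInstance, inferInstance,
    fun ω => univ.image ω.1 ∪ blocks b ω.2, fun ω => ?_, fun f hf hδ => ?_⟩
  · refine (Finset.card_union_le _ _).trans (add_le_add ?_ (card_blocks_le hb _))
    exact Finset.card_image_le.trans (by simp)
  set q : ℝ := (((ℓ / b + 1 : ℕ) : ℝ) ^ m)⁻¹ with hq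
  have hq0 : 0 ≤ q := by positivity
  let Φ : ((Fin ℓ → Msg r) → ℝ) → ℝ := fun g =>
    𝔼 h : Fin m → Fin (ℓ / b + 1), if 1 - ε ≤ 𝔼 x, control (blocks b h) g x then (1 : ℝ) else 0
  have hΦ0 : ∀ g, 0 ≤ Φ g := fun g => Finset.expect_nonneg fun _ _ => by split_ifs <;> norm_num
  have ind_mono : ∀ {a b : ℝ}, a ≤ b →
      (if 1 - ε ≤ a then (1 : ℝ) else 0) ≤ if 1 - ε ≤ b then (1 : ℝ) else 0 := by
    intro a b hab
    split_ifs with h1 h2 <;> first | exact absurd (h1.trans hab) h2 | norm_num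
  have hΦ : ∀ g g', (∀ x, g x ≤ g' x) → Φ g ≤ Φ g' := fun g g' hg =>
    Finset.expect_le_expect fun h _ => ind_mono <|
      Finset.expect_le_expect fun x _ => control_mono hg _ x
  have hgain : ∀ g : (Fin ℓ → Msg r) → ℝ, (∀ x, g x = 0 ∨ g x = 1) →
      q ≤ Φ g ∨ (1 + κ) * 𝔼 x, g x ≤ 𝔼 p, 𝔼 x, control {p} g x := by
    intro g hg
    refine (exists_coalition_or_gain hg hK hε (by simpa using hκ)).imp_left ?_
    rintro ⟨J, hJ, hJ'⟩
    obtain ⟨h, hh⟩ := exists_subset_blocks (b := b) J (by exact_mod_cast hJ.trans hm)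
    have h1 : 1 - ε ≤ 𝔼 x, control (blocks b h) g x :=
      hJ'.trans (Finset.expect_le_expect fun x _ => control_mono_set hh g x)
    simp only [Φ]
    rw [Fintype.expect_eq_sum_div_card]
    have h2 := Finset.single_le_sum (s := univ)
      (f := fun h => if 1 - ε ≤ 𝔼 x, control (blocks b h) g x then (1 : ℝ) else 0)
      (fun _ _ => by split_ifs <;> norm_num) (Finset.mem_univ h)
    rw [if_pos h1] at h2
    rw [hq, ← one_div]
    have h3 : (Fintype.card (Fin m → Fin (ℓ / b + 1)) : ℝ) = ((ℓ / b + 1 : ℕ) : ℝ) ^ m := by simp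
    rw [h3]
    gcongr
  have main := le_expect_control_sequence hΦ0 hΦ hq0 hκ0 hgain N f hf
  have h1 : δ / 2 * q ≤ q * (𝔼 x, f x - ((1 + κ)⁻¹) ^ N) := by
    rw [mul_comm]
    exact mul_le_mul_of_nonneg_left (by linarith) hq0
  refine h1.trans (main.trans ?_)
  rw [← Finset.univ_product_univ, Finset.expect_product]
  refine Finset.expect_le_expect fun c _ => Finset.expect_le_expect fun h _ => ind_mono <|
    Finset.expect_le_expect fun x _ => ?_
  have := control_control_le (blocks b h) (univ.image c) f x
  rwa [Finset.union_comm] at this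

end Blocks

section Value

lemma prob_eq_expect {Ω : Type} [Fintype Ω] (f : Ω → Bool) :
    prob f = 𝔼 ω, if f ω = true then (1 : ℝ) else 0 := by
  rw [prob, Fintype.expect_eq_sum_div_card, Finset.sum_boole]

/-- The protocol that remains after the first-round messages `m`. -/
def Protocol.rest {ℓ k : ℕ} {r : Fin (k + 1) → ℕ} (π : Protocol ℓ (k + 1) r)
    (m : Fin ℓ → Msg (r 0)) : Protocol ℓ k (fun i => r i.succ) :=
  fun t => π (Fin.cons (α := fun i => Fin ℓ → Msg (r i)) m t)

/-- The probability of outcome `1` when the players in `B` play optimally. -/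
noncomputable def val {ℓ : ℕ} (B : Finset (Fin ℓ)) :
    (k : ℕ) → (r : Fin k → ℕ) → Protocol ℓ k r → ℝ
  | 0, _, π => if π (fun i => i.elim0) = true then 1 else 0
  | k + 1, r, π => 𝔼 m, control B (fun m => val B k (fun i => r i.succ) (π.rest m)) m

lemma expect_expect_cons {k : ℕ} {M : Fin (k + 1) → Type} [∀ i, Fintype (M i)]
    (F : ((i : Fin (k + 1)) → M i) → ℝ) :
    𝔼 m : M 0, 𝔼 t : (i : Fin k) → M i.succ, F (Fin.cons m t) = 𝔼 x, F x := by
  rw [← Finset.expect_product' univ univ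
    (fun (m : M 0) (t : (i : Fin k) → M i.succ) => F (Fin.cons m t)), Finset.univ_product_univ]
  exact Fintype.expect_equiv (Fin.consEquiv M) _ _ fun z => rfl

lemma expect_prob_rest {ℓ k : ℕ} {r : Fin (k + 1) → ℕ} (π : Protocol ℓ (k + 1) r) :
    𝔼 m, prob (π.rest m) = prob π := by
  simp only [prob_eq_expect]
  exact expect_expect_cons (M := fun i => Fin ℓ → Msg (r i))
    (fun x => if π x = true then (1 : ℝ) else 0)

lemma val_nonneg {ℓ : ℕ} (B : Finset (Fin ℓ)) {k : ℕ} {r : Fin k → ℕ} (π : Protocol ℓ k r) :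
    0 ≤ val B k r π := by
  induction k with
  | zero => unfold val; split_ifs <;> norm_num
  | succ k ih =>
    unfold val
    exact Finset.expect_nonneg fun m _ => (ih _).trans (self_le_control B
      (fun m => val B k (fun i => r i.succ) (π.rest m)) m)

lemma val_mono {ℓ : ℕ} {B B' : Finset (Fin ℓ)} (h : B ⊆ B') {k : ℕ} {r : Fin k → ℕ}
    (π : Protocol ℓ k r) : val B k r π ≤ val B' k r π := by
  induction k with
  | zero => simp [val]
  | succ k ih =>
    unfold val
    exact Finset.expect_le_expect fun m _ =>
      (control_mono (fun m => ih _) B m).trans (control_mono_set h _ m)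

/-- The strategy that answers by `ρ` in the first round and continues with `σ m` when the
first-round messages are `m`. -/
def Adversary.cons {ℓ k : ℕ} {r : Fin (k + 1) → ℕ} {B : Finset (Fin ℓ)}
    (ρ : ({p : Fin ℓ // p ∉ B} → Msg (r 0)) → ({p : Fin ℓ // p ∈ B} → Msg (r 0)))
    (σ : (Fin ℓ → Msg (r 0)) → Adversary ℓ k (fun i => r i.succ) B) :
    Adversary ℓ (k + 1) r B :=
  fun i => Fin.cases
    (motive := fun i => ((j : Fin (k + 1)) → j < i → Fin ℓ → Msg (r j)) →
      ({p : Fin ℓ // p ∉ B} → Msg (r i)) → ({p : Fin ℓ // p ∈ B} → Msg (r i)))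
    (fun _ g => ρ g)
    (fun i h g => σ (h 0 (Fin.succ_pos i)) i
      (fun j hj => h j.succ (Fin.succ_lt_succ_iff.2 hj)) g) i

/-- The messages of all players, given those of the good and those of the bad players. -/
def mergeMsg {ℓ : ℕ} {α : Type} {B : Finset (Fin ℓ)} (g : {p : Fin ℓ // p ∉ B} → α)
    (y : {p : Fin ℓ // p ∈ B} → α) (p : Fin ℓ) : α :=
  if h : p ∈ B then y ⟨p, h⟩ else g ⟨p, h⟩

lemma play_cons_zero {ℓ k : ℕ} {r : Fin (k + 1) → ℕ} {B : Finset (Fin ℓ)}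
    (ρ : ({p : Fin ℓ // p ∉ B} → Msg (r 0)) → ({p : Fin ℓ // p ∈ B} → Msg (r 0)))
    (σ : (Fin ℓ → Msg (r 0)) → Adversary ℓ k (fun i => r i.succ) B)
    (x : GoodCoins ℓ (k + 1) r B) :
    play (Adversary.cons ρ σ) x 0 = mergeMsg (x 0) (ρ (x 0)) := by
  funext p
  rw [play]
  rfl

lemma play_cons_succ {ℓ k : ℕ} {r : Fin (k + 1) → ℕ} {B : Finset (Fin ℓ)}
    (ρ : ({p : Fin ℓ // p ∉ B} → Msg (r 0)) → ({p : Fin ℓ // p ∈ B} → Msg (r 0)))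
    (σ : (Fin ℓ → Msg (r 0)) → Adversary ℓ k (fun i => r i.succ) B)
    (x : GoodCoins ℓ (k + 1) r B) (i : Fin k) :
    play (Adversary.cons ρ σ) x i.succ =
      play (σ (mergeMsg (x 0) (ρ (x 0)))) (fun j => x j.succ) i := by
  have ih : ∀ j : Fin k, j < i → play (Adversary.cons ρ σ) x j.succ =
      play (σ (mergeMsg (x 0) (ρ (x 0)))) (fun j => x j.succ) j :=
    fun j _ => play_cons_succ ρ σ x j
  funext p
  rw [play, play]
  by_cases h : p ∈ B
  · simp only [h, dite_true, Adversary.cons, Fin.cases_succ]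
    have h0 : play (Adversary.cons ρ σ) x 0 = mergeMsg (x 0) (ρ (x 0)) := play_cons_zero ρ σ x
    change σ (play (Adversary.cons ρ σ) x 0) i
      (fun j _ => play (Adversary.cons ρ σ) x j.succ) (x i.succ) ⟨p, h⟩ = _
    rw [h0]
    congr 1
    exact funext fun j => funext fun hj => ih j hj
  · simp only [h, dite_false]
termination_by i.val

lemma expect_mergeMsg {ℓ : ℕ} {α : Type} [Fintype α] [Nonempty α] {B : Finset (Fin ℓ)}
    (F : (Fin ℓ → α) → ℝ) (a : α)
    (hF : ∀ m m' : Fin ℓ → α, (∀ p, p ∉ B → m p = m' p) → F m = F m') :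
    𝔼 g : {p : Fin ℓ // p ∉ B} → α, F (mergeMsg g fun _ => a) = 𝔼 m, F m := by
  have h1 : 𝔼 m, F m = 𝔼 z : ({p : Fin ℓ // p ∈ B} → α) × ({p : Fin ℓ // p ∉ B} → α),
      F (mergeMsg z.2 fun _ => a) := by
    refine Fintype.expect_equiv (Equiv.piEquivPiSubtypeProd (· ∈ B) fun _ => α) _ _ fun m => ?_
    refine hF _ _ fun p hp => ?_
    simp [mergeMsg, hp, Equiv.piEquivPiSubtypeProd]
  rw [h1, ← Finset.univ_product_univ, Finset.expect_product]
  exact (Finset.expect_const univ_nonempty _).symm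

lemma control_congr {P α : Type*} [DecidableEq P] {B : Finset P} (f : (P → α) → ℝ)
    {m m' : P → α} (h : ∀ p, p ∉ B → m p = m' p) : control B f m = control B f m' := by
  unfold control
  congr 1
  funext y
  congr 1
  ext p
  by_cases hp : p ∈ B
  · simp [hp]
  · simp [hp, h p hp]

/-- The value of a protocol is attained by a strategy. -/
lemma exists_adversary {ℓ : ℕ} (B : Finset (Fin ℓ)) {k : ℕ} {r : Fin k → ℕ}
    (π : Protocol ℓ k r) : ∃ σ : Adversary ℓ k r B, prob (fun x => π (play σ x)) = val B k r π := by
  induction k with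
  | zero =>
    refine ⟨fun i => i.elim0, ?_⟩
    rw [prob_eq_expect, val]
    have : ∀ x : GoodCoins ℓ 0 r B,
        π (play (fun i => i.elim0 : Adversary ℓ 0 r B) x) = π (fun i => i.elim0) := fun x =>
      congrArg π (funext fun i => i.elim0)
    simp only [this]
    rw [Finset.expect_const univ_nonempty]
  | succ k ih =>
    choose σ hσ using fun m : Fin ℓ → Msg (r 0) => ih (π.rest m)
    let a : Msg (r 0) := fun _ => false
    let F : (Fin ℓ → Msg (r 0)) → ℝ := fun m => val B k (fun i => r i.succ) (π.rest m)
    choose y hy using fun g : {p : Fin ℓ // p ∉ B} → Msg (r 0) =>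
      exists_control_eq B F (mergeMsg g fun _ => a)
    let ρ : ({p : Fin ℓ // p ∉ B} → Msg (r 0)) → ({p : Fin ℓ // p ∈ B} → Msg (r 0)) :=
      fun g p => y g p
    have hmerge : ∀ g, mergeMsg g (ρ g) = B.piecewise (y g) (mergeMsg g fun _ => a) := by
      intro g
      funext p
      by_cases hp : p ∈ B <;> simp [mergeMsg, hp, ρ]
    refine ⟨Adversary.cons ρ σ, ?_⟩
    have hplay : ∀ (g : {p : Fin ℓ // p ∉ B} → Msg (r 0))
        (t : GoodCoins ℓ k (fun i => r i.succ) B),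
        π (play (Adversary.cons ρ σ) (Fin.cons (α := fun i => {p : Fin ℓ // p ∉ B} → Msg (r i)) g t))
          = π.rest (mergeMsg g (ρ g)) (play (σ (mergeMsg g (ρ g))) t) := by
      intro g t
      unfold Protocol.rest
      congr 1
      funext i
      refine Fin.cases ?_ (fun i => ?_) i
      · rw [play_cons_zero]; rfl
      · rw [play_cons_succ]; rfl
    rw [prob_eq_expect, ← expect_expect_cons (M := fun i => {p : Fin ℓ // p ∉ B} → Msg (r i))]
    simp only [hplay]
    rw [val, ← expect_mergeMsg (B := B) (fun m => control B F m) a fun m m' h => control_congr F h]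
    refine Finset.expect_congr rfl fun g _ => ?_
    rw [← hy g, ← hmerge g]
    simp only [F]
    rw [← hσ, prob_eq_expect]

end Value

section Composition

lemma le_expect_ite_of_add_le {Ω : Type*} [Fintype Ω] [Nonempty Ω] {g : Ω → ℝ} {a t : ℝ}
    (ha : 0 ≤ a) (hg : ∀ ω, g ω ≤ 1) (h : a + t ≤ 𝔼 ω, g ω) :
    t ≤ 𝔼 ω, if a ≤ g ω then (1 : ℝ) else 0 := by
  have : 𝔼 ω, g ω ≤ 𝔼 ω, ((if a ≤ g ω then (1 : ℝ) else 0) + a) :=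
    Finset.expect_le_expect fun ω _ => by
      have := hg ω
      split_ifs with h' <;> linarith
  rw [Finset.expect_add_distrib, Finset.expect_const univ_nonempty] at this
  linarith

/-- A single distribution on coalitions of size at most `s` controls every one-round protocol
with `n`-bit messages of mean at least `δ` up to error `ε`, with probability at least `η`. -/
def RoundAttackable (ℓ n : ℕ) (δ ε η s : ℝ) : Prop :=
  ∃ (Ω : Type) (_ : Fintype Ω) (_ : Nonempty Ω) (B : Ω → Finset (Fin ℓ)),
    (∀ ω, ((B ω).card : ℝ) ≤ s) ∧
    ∀ f : (Fin ℓ → Msg n) → ℝ, (∀ x, f x = 0 ∨ f x = 1) → δ ≤ 𝔼 x, f x →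
      η ≤ 𝔼 ω, if 1 - ε ≤ 𝔼 x, control (B ω) f x then (1 : ℝ) else 0

/-- A single distribution on coalitions of size at most `s` controls every protocol with messages
of lengths `r` whose outcome is `1` with probability at least `δ`, up to error `ε`, with
probability at least `η`. -/
def Attackable (ℓ k : ℕ) (r : Fin k → ℕ) (δ ε η s : ℝ) : Prop :=
  ∃ (Ω : Type) (_ : Fintype Ω) (_ : Nonempty Ω) (B : Ω → Finset (Fin ℓ)),
    (∀ ω, ((B ω).card : ℝ) ≤ s) ∧
    ∀ π : Protocol ℓ k r, δ ≤ prob π →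
      η ≤ 𝔼 ω, if 1 - ε ≤ val (B ω) k r π then (1 : ℝ) else 0

lemma attackable_zero (ℓ : ℕ) (r : Fin 0 → ℕ) {δ ε η s : ℝ} (hδ : 0 < δ) (hε : 0 ≤ ε)
    (hη : η ≤ 1) (hs : 0 ≤ s) : Attackable ℓ 0 r δ ε η s := by
  refine ⟨Unit, inferInstance, inferInstance, fun _ => ∅, by simpa using hs, fun π hπ => ?_⟩
  have h1 : π (fun i => i.elim0) = true := by
    by_contra hne
    have : ∀ t, π t = false := fun t => by
      rw [Subsingleton.elim t (fun i => i.elim0)]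
      simpa using hne
    simp [prob, this] at hπ
    linarith
  simp [val, h1, hε, hη]

lemma prob_le_one {Ω : Type} [Fintype Ω] [Nonempty Ω] (f : Ω → Bool) : prob f ≤ 1 := by
  rw [prob_eq_expect]
  exact Finset.expect_le univ_nonempty fun ω _ => by split_ifs <;> norm_num

lemma mul_expect_control_le_val {ℓ k : ℕ} {r : Fin (k + 1) → ℕ} (π : Protocol ℓ (k + 1) r)
    (B₁ B₂ : Finset (Fin ℓ)) {c : ℝ} :
    c * 𝔼 m, control B₁ (fun m => if c ≤ val B₂ k (fun i => r i.succ) (π.rest m)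
      then (1 : ℝ) else 0) m ≤ val (B₂ ∪ B₁) (k + 1) r π := by
  rw [val, Finset.mul_expect]
  refine Finset.expect_le_expect fun m _ => ?_
  refine le_trans ?_ (control_mono_set Finset.subset_union_right _ m)
  obtain ⟨y, hy⟩ := exists_control_eq B₁ (fun m => if c ≤ val B₂ k (fun i => r i.succ) (π.rest m)
      then (1 : ℝ) else 0) m
  rw [← hy]
  refine le_trans ?_ (le_control B₁ _ m y)
  refine le_trans ?_ (val_mono Finset.subset_union_left _)
  split_ifs with h
  · simpa using h
  · simpa using val_nonneg _ _

/-- Prepending a round to an attackable family of protocols. -/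
lemma Attackable.cons {ℓ k : ℕ} {r : Fin (k + 1) → ℕ} {δ ε η s θ ε₁ η₁ s₁ : ℝ}
    (h : Attackable ℓ k (fun i => r i.succ) δ ε η s)
    (h₁ : RoundAttackable ℓ (r 0) (θ * η / 2) ε₁ η₁ s₁) (hδ : 0 ≤ δ) (hη : 0 ≤ η) (hθ : 0 ≤ θ)
    (hε : 0 ≤ ε) (hε' : ε ≤ 1) (hε₁ : 0 ≤ ε₁) (hη₁ : 0 ≤ η₁) :
    Attackable ℓ (k + 1) r (δ + θ) (ε + ε₁) (θ * η / 2 * η₁) (s + s₁) := by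
  obtain ⟨Ω, _, _, B, hB, hBπ⟩ := h
  obtain ⟨Ω₁, _, _, B₁, hB₁, hB₁f⟩ := h₁
  refine ⟨Ω × Ω₁, inferInstance, inferInstance, fun ω => B ω.1 ∪ B₁ ω.2, fun ω => ?_,
    fun π hπ => ?_⟩
  · calc ((B ω.1 ∪ B₁ ω.2).card : ℝ) ≤ ((B ω.1).card + (B₁ ω.2).card : ℕ) := by
          exact_mod_cast Finset.card_union_le _ _
      _ ≤ s + s₁ := by push_cast; exact add_le_add (hB _) (hB₁ _)
  let F : Ω → (Fin ℓ → Msg (r 0)) → ℝ := fun ω m =>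
    if 1 - ε ≤ val (B ω) k (fun i => r i.succ) (π.rest m) then (1 : ℝ) else 0
  have hF : ∀ ω m, F ω m = 0 ∨ F ω m = 1 := fun ω m => by
    simp only [F]; split_ifs <;> simp
  have hθm : θ ≤ 𝔼 m, if δ ≤ prob (π.rest m) then (1 : ℝ) else 0 :=
    le_expect_ite_of_add_le hδ (fun m => prob_le_one _) (by rwa [expect_prob_rest])
  have hmean : θ * η / 2 + θ * η / 2 ≤ 𝔼 ω, 𝔼 m, F ω m := by
    rw [Finset.expect_comm, add_halves]
    refine (mul_le_mul_of_nonneg_right hθm hη).trans ?_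
    rw [Finset.expect_mul]
    refine Finset.expect_le_expect fun m _ => ?_
    split_ifs with hm
    · rw [one_mul]; exact hBπ _ hm
    · simpa using Finset.expect_nonneg fun ω _ => by
        rcases hF ω m with h | h <;> simp [h]
  have hω := le_expect_ite_of_add_le (by positivity)
    (fun ω => Finset.expect_le univ_nonempty fun m _ => by
      rcases hF ω m with h | h <;> simp [h]) hmean
  refine (mul_le_mul_of_nonneg_right hω hη₁).trans ?_
  rw [Finset.expect_mul, ← Finset.univ_product_univ, Finset.expect_product]
  refine Finset.expect_le_expect fun ω _ => ?_
  split_ifs with hm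
  · rw [one_mul]
    refine (hB₁f _ (hF ω) hm).trans (Finset.expect_le_expect fun ω₁ _ => ?_)
    by_cases hc : 1 - ε₁ ≤ 𝔼 x, control (B₁ ω₁) (F ω) x
    · have h2 := mul_expect_control_le_val π (B₁ ω₁) (B ω) (c := 1 - ε)
      have h3 : (1 - ε) * (1 - ε₁) ≤ (1 - ε) * 𝔼 x, control (B₁ ω₁) (F ω) x :=
        mul_le_mul_of_nonneg_left hc (by linarith)
      have h4 : 1 - (ε + ε₁) ≤ val (B ω ∪ B₁ ω₁) (k + 1) r π := by
        refine le_trans ?_ (h3.trans h2)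
        nlinarith
      rw [if_pos hc, if_pos h4]
    · rw [if_neg hc]
      split_ifs <;> norm_num
  · rw [zero_mul]
    exact Finset.expect_nonneg fun _ _ => by split_ifs <;> norm_num

end Composition

section Parameters

open Filter

lemma isLittleO_rpow_rpow {p q : ℝ} (h : p < q) :
    (fun y : ℝ => y ^ p) =o[atTop] fun y : ℝ => y ^ q := by
  refine (Asymptotics.isLittleO_iff_tendsto' ?_).2 ?_
  · filter_upwards [eventually_gt_atTop 0] with y hy h0
    exact absurd h0 (Real.rpow_pos_of_pos hy q).ne'
  · refine (tendsto_rpow_neg_atTop (sub_pos.2 h)).congr' ?_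
    filter_upwards [eventually_gt_atTop 0] with y hy
    rw [← Real.rpow_sub hy, neg_sub]

lemma inv_one_add_le_exp {κ : ℝ} (h0 : 0 ≤ κ) (h1 : κ ≤ 1) :
    (1 + κ)⁻¹ ≤ Real.exp (-(κ / 2)) := by
  have h2 := Real.exp_bound_div_one_sub_of_interval (x := κ / 2) (by linarith) (by linarith)
  rw [Real.exp_neg]
  gcongr
  refine h2.trans ?_
  rw [div_le_iff₀ (by linarith)]
  nlinarith

lemma nineteen_le_exp_three : (19 : ℝ) ≤ Real.exp 3 := by
  have := Real.exp_one_gt_d9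
  have h : Real.exp 3 = Real.exp 1 ^ 3 := by rw [← Real.exp_nat_mul]; norm_num
  rw [h]
  calc (19 : ℝ) ≤ 2.7 ^ 3 := by norm_num
    _ ≤ _ := by gcongr; linarith

lemma half_le_floor {z : ℝ} (hz : 1 ≤ z) : z / 2 ≤ ⌊z⌋₊ := by
  have h1 := Nat.lt_floor_add_one z
  have h2 : (1 : ℝ) ≤ ⌊z⌋₊ := by exact_mod_cast Nat.one_le_floor_iff z |>.2 hz
  linarith

/-- The logarithm of `2 / δ` for `δ = y ^ (-1/1000) * 2 ^ (-y ^ (1/1000)) / 2`. -/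
lemma eventually_log_le : ∀ᶠ y : ℝ in atTop,
    Real.log 4 + 1 / 1000 * Real.log y + y ^ (1 / 1000 : ℝ) * Real.log 2 ≤
      y ^ (2 / 1000 : ℝ) := by
  have h1 : (fun _ : ℝ => Real.log 4) =o[atTop] fun y : ℝ => y ^ (2 / 1000 : ℝ) :=
    Asymptotics.isLittleO_const_left.2 <| Or.inr <|
      (tendsto_norm_atTop_atTop.comp (tendsto_rpow_atTop (by norm_num)))
  have h2 : (fun y : ℝ => 1 / 1000 * Real.log y) =o[atTop] fun y : ℝ => y ^ (2 / 1000 : ℝ) :=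
    (isLittleO_log_rpow_atTop (by norm_num)).const_mul_left _
  have h3 : (fun y : ℝ => y ^ (1 / 1000 : ℝ) * Real.log 2) =o[atTop]
      fun y : ℝ => y ^ (2 / 1000 : ℝ) := by
    simp_rw [mul_comm _ (Real.log 2)]
    exact (isLittleO_rpow_rpow (by norm_num)).const_mul_left _
  filter_upwards [((h1.add h2).add h3).bound one_pos, eventually_ge_atTop 0] with y hy hy0
  rw [one_mul, Real.norm_of_nonneg (Real.rpow_nonneg hy0 _)] at hy
  exact (le_abs_self _).trans hy

lemma eventually_rpow_le : ∀ᶠ y : ℝ in atTop,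
    7 * y ^ (996 / 1000 : ℝ) + 3 ≤ y * Real.log 2 / 1000 := by
  have hlog : 0 < Real.log 2 := Real.log_pos (by norm_num)
  have h1 : (fun y : ℝ => y ^ (996 / 1000 : ℝ)) =o[atTop] fun y : ℝ => y := by
    simpa using isLittleO_rpow_rpow (p := 996 / 1000) (q := 1) (by norm_num)
  have h2 := h1.bound (show 0 < Real.log 2 / 14000 by positivity)
  filter_upwards [h2, eventually_ge_atTop (6000 / Real.log 2), eventually_ge_atTop 0]
    with y hy hy1 hy0
  rw [Real.norm_of_nonneg (Real.rpow_nonneg hy0 _), Real.norm_of_nonneg hy0] at hy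
  rw [div_le_iff₀ hlog] at hy1
  linarith

set_option maxHeartbeats 2000000 in
/-- One round can be attacked when the messages are short compared with `y ≤ log₂ ℓ`. -/
lemma eventually_roundAttackable : ∀ᶠ y : ℝ in atTop, ∀ ℓ n : ℕ,
    (2 : ℝ) ^ y ≤ ℓ → (n : ℝ) ≤ y ^ (99 / 100 : ℝ) →
    ∃ η₁ : ℝ, 0 ≤ η₁ ∧
      (2 : ℝ) ^ (-((2 : ℝ) ^ y) ^ (1 / 1000 : ℝ)) ≤
        y ^ (-(1 / 1000) : ℝ) * (2 : ℝ) ^ (-y ^ (1 / 1000 : ℝ)) / 2 * η₁ ∧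
      RoundAttackable ℓ n (y ^ (-(1 / 1000) : ℝ) * (2 : ℝ) ^ (-y ^ (1 / 1000 : ℝ)) / 2)
        (y ^ (-(1 / 1000) : ℝ)) η₁ (y ^ (-(1 / 1000) : ℝ) * ℓ) := by
  have h16 : ∀ᶠ y : ℝ in atTop, 16 ≤ y ^ (2 / 1000 : ℝ) :=
    (tendsto_rpow_atTop (by norm_num)).eventually_ge_atTop 16
  filter_upwards [eventually_log_le, eventually_rpow_le, h16, eventually_ge_atTop 1]
    with y hD hw h16 hy1 ℓ n hℓ hn
  have hy0 : 0 < y := by linarith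
  have hlog2 : 0.69 < Real.log 2 := by linarith [Real.log_two_gt_d9]
  set t : ℝ := y ^ (-(1 / 1000) : ℝ) with ht
  set δ : ℝ := t * (2 : ℝ) ^ (-y ^ (1 / 1000 : ℝ)) / 2 with hδ
  have ht0 : 0 < t := Real.rpow_pos_of_pos hy0 _
  have ht1 : t ≤ 1 := Real.rpow_le_one_of_one_le_of_nonpos hy1 (by norm_num)
  have htinv : t⁻¹ = y ^ (1 / 1000 : ℝ) := by rw [ht, Real.rpow_neg hy0.le, inv_inv]
  have hδ0 : 0 < δ := by positivity
  set D : ℝ := Real.log (2 / δ) with hDdef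
  have hDeq : D = Real.log 4 + 1 / 1000 * Real.log y + y ^ (1 / 1000 : ℝ) * Real.log 2 := by
    have : 2 / δ = 4 * (y ^ (1 / 1000 : ℝ) * (2 : ℝ) ^ (y ^ (1 / 1000 : ℝ))) := by
      rw [hδ, Real.rpow_neg (by norm_num), ← htinv]
      field_simp
      norm_num
    rw [hDdef, this, Real.log_mul (by norm_num) (by positivity),
      Real.log_mul (by positivity) (by positivity), Real.log_rpow hy0, Real.log_rpow (by norm_num)]
    ring
  rw [← hDeq] at hD
  have hexpD : Real.exp (-D) = δ / 2 := by
    rw [hDdef, Real.exp_neg, Real.exp_log (by positivity), inv_div]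
  have hD0 : 0 ≤ D := by
    rw [hDeq]
    have := Real.log_nonneg hy1
    have := Real.log_nonneg (show (1 : ℝ) ≤ 4 by norm_num)
    positivity
  set w : ℝ := y ^ (996 / 1000 : ℝ) with hwdef
  have hyw : ∀ s : ℝ, s ≤ 996 / 1000 → y ^ s ≤ w := fun s hs =>
    Real.rpow_le_rpow_of_exponent_le hy1 hs
  have hwexp : w + 1 ≤ Real.exp w := Real.add_one_le_exp w
  have hw1 : 1 ≤ w := Real.one_le_rpow hy1 (by norm_num)
  set K : ℝ := y ^ (995 / 1000 : ℝ) with hKdef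
  have hK0 : 0 < K := Real.rpow_pos_of_pos hy0 _
  have hKt : 2 * K / t = 2 * w := by
    rw [div_eq_mul_inv, htinv, hKdef, hwdef, mul_assoc, ← Real.rpow_add hy0]
    norm_num
  set m : ℕ := ⌈K * Real.exp (2 * K / t)⌉₊ with hmdef
  have hm : K * Real.exp (2 * K / t) ≤ m := Nat.le_ceil _
  have hmpos : (0 : ℝ) < m := lt_of_lt_of_le (by positivity) hm
  have hm1 : (1 : ℝ) ≤ m := by exact_mod_cast Nat.one_le_iff_ne_zero.2 (by
    rintro h; rw [h] at hmpos; simp at hmpos)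
  have hmle : (m : ℝ) ≤ Real.exp (3 * w) := by
    have h1 : (m : ℝ) ≤ K * Real.exp (2 * K / t) + 1 := (Nat.ceil_lt_add_one (by positivity)).le
    have h2 : Real.exp (3 * w) = Real.exp w * Real.exp (2 * w) := by
      rw [← Real.exp_add]; ring_nf
    have h3 : 1 ≤ Real.exp (2 * w) := Real.one_le_exp (by linarith)
    have h4 : K ≤ w := hyw _ (by norm_num)
    have h5 := mul_le_mul_of_nonneg_right (h4.trans (sub_nonneg.1 (by linarith)) :
      K ≤ Real.exp w - 1) (zero_le_one.trans h3)
    rw [hKt] at h1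
    rw [h2]
    linarith
  have hℓexp : Real.exp (7 * w + 3) ≤ ℓ := by
    refine le_trans ?_ hℓ
    rw [Real.rpow_def_of_pos (by norm_num)]
    refine Real.exp_le_exp.2 (hw.trans ?_)
    have := mul_nonneg hy0.le (show 0 ≤ Real.log 2 by linarith)
    linarith
  have h8 : (8 : ℝ) ≤ Real.exp 3 := by linarith [nineteen_le_exp_three]
  have hℓ0 : (0 : ℝ) < ℓ := (Real.exp_pos _).trans_le hℓexp
  have htinvw : t⁻¹ ≤ Real.exp w := by
    rw [htinv]; linarith [hyw (1 / 1000) (by norm_num)]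
  have hDw : D ≤ Real.exp w := by linarith [hyw (2 / 1000) (by norm_num)]
  have hbig : ∀ z : ℝ, z ≤ Real.exp (6 * w) → 8 * z ≤ t * ℓ := by
    intro z hz
    have h1 : Real.exp (7 * w + 3) = Real.exp 3 * Real.exp (6 * w) * Real.exp w := by
      rw [← Real.exp_add, ← Real.exp_add]; ring_nf
    have h2 : Real.exp 3 * Real.exp (6 * w) * t⁻¹ ≤ ℓ := by
      refine le_trans ?_ (h1 ▸ hℓexp)
      gcongr
    rw [← div_eq_mul_inv, div_le_iff₀ ht0] at h2
    have h3 : 8 * z ≤ Real.exp 3 * Real.exp (6 * w) :=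
      (mul_le_mul_of_nonneg_left hz (by norm_num)).trans
        (mul_le_mul_of_nonneg_right h8 (Real.exp_pos _).le)
    linarith
  have h8D : 8 * D ≤ t * ℓ := hbig D (hDw.trans (Real.exp_le_exp.2 (by linarith)))
  have h8m : 8 * (m : ℝ) ≤ t * ℓ := hbig m (hmle.trans (Real.exp_le_exp.2 (by linarith)))
  have hN1 := half_le_floor (show 1 ≤ t * ℓ / 2 by linarith)
  have hN2 := Nat.floor_le (show 0 ≤ t * ℓ / 2 by positivity)
  have hb1 := half_le_floor (show 1 ≤ t * ℓ / (2 * m) by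
    rw [le_div_iff₀ (by positivity)]; linarith)
  have hb2 := Nat.floor_le (show 0 ≤ t * ℓ / (2 * m) by positivity)
  set N : ℕ := ⌊t * ℓ / 2⌋₊
  set b : ℕ := ⌊t * ℓ / (2 * m)⌋₊
  have hb0 : (0 : ℝ) < b := lt_of_lt_of_le (by positivity) hb1
  set κ : ℝ := 8 * D / (t * ℓ) with hκdef
  have hκ0 : 0 ≤ κ := by positivity
  have hκ1 : κ ≤ 1 := by rw [hκdef, div_le_one (by positivity)]; exact h8D
  have hκK : κ * (2 * n * ℓ) ≤ K := by
    have h1 : κ * (2 * n * ℓ) = 16 * n * D * t⁻¹ := by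
      rw [hκdef]; field_simp; ring
    have h2 : K = y ^ (2 / 1000 : ℝ) * y ^ (99 / 100 : ℝ) * y ^ (2 / 1000 : ℝ) *
        y ^ (1 / 1000 : ℝ) := by
      rw [hKdef, ← Real.rpow_add hy0, ← Real.rpow_add hy0, ← Real.rpow_add hy0]; norm_num
    rw [h1, h2, htinv]
    gcongr
  have hpow : ((1 + κ)⁻¹) ^ N ≤ δ / 2 := by
    have h1 := inv_one_add_le_exp hκ0 hκ1
    calc ((1 + κ)⁻¹) ^ N ≤ Real.exp (-(κ / 2)) ^ N := by gcongr
      _ = Real.exp (N * -(κ / 2)) := by rw [Real.exp_nat_mul]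
      _ ≤ Real.exp (-D) := by
        refine Real.exp_le_exp.2 ?_
        have h3 : D = t * ℓ / 2 / 2 * (κ / 2) := by rw [hκdef]; field_simp; ring
        have h4 : t * ℓ / 2 / 2 * (κ / 2) ≤ N * (κ / 2) := by gcongr
        linarith
      _ = δ / 2 := hexpD
  set Q : ℝ := ((ℓ / b + 1 : ℕ) : ℝ) with hQdef
  have hQ0 : 0 < Q := by rw [hQdef]; positivity
  have hQ : Q ≤ 5 * m * t⁻¹ := by
    have h1 : Q ≤ ℓ / b + 1 := by rw [hQdef]; push_cast; gcongr; exact Nat.cast_div_le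
    have h2 : (ℓ : ℝ) / b ≤ 4 * m * t⁻¹ := by
      rw [div_le_iff₀ hb0]
      calc (ℓ : ℝ) = 4 * m * t⁻¹ * (t * ℓ / (2 * m) / 2) := by field_simp; norm_num
        _ ≤ _ := by gcongr
    have h3 : 1 ≤ m * t⁻¹ := one_le_mul_of_one_le_of_one_le hm1 (one_le_inv₀ ht0 |>.2 ht1)
    linarith
  have hQm : Q ^ m ≤ Real.exp (5 * m ^ 2 * t⁻¹) := by
    have h1 : Q ≤ Real.exp Q := by linarith [Real.add_one_le_exp Q]
    calc Q ^ m ≤ Real.exp Q ^ m := by gcongr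
      _ = Real.exp (m * Q) := by rw [Real.exp_nat_mul]
      _ ≤ _ := by
        refine Real.exp_le_exp.2 ?_
        calc (m : ℝ) * Q ≤ m * (5 * m * t⁻¹) := by gcongr
          _ = _ := by ring
  have hfinal : 2 * D + 5 * m ^ 2 * t⁻¹ ≤ ((2 : ℝ) ^ y) ^ (1 / 1000 : ℝ) * Real.log 2 := by
    have h1 : ((2 : ℝ) ^ y) ^ (1 / 1000 : ℝ) = Real.exp (y * Real.log 2 / 1000) := by
      rw [← Real.rpow_mul (by norm_num), Real.rpow_def_of_pos (by norm_num)]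
      ring_nf
    have h2 : Real.exp (7 * w + 3) ≤ Real.exp (y * Real.log 2 / 1000) := Real.exp_le_exp.2 hw
    have h3 : Real.exp (7 * w + 3) = Real.exp (7 * w) * Real.exp 3 := Real.exp_add _ _
    have h4 := nineteen_le_exp_three
    have h5 : 5 * (m : ℝ) ^ 2 * t⁻¹ ≤ 5 * Real.exp (7 * w) := by
      calc 5 * (m : ℝ) ^ 2 * t⁻¹ ≤ 5 * Real.exp (3 * w) ^ 2 * Real.exp w := by gcongr
        _ = 5 * Real.exp (7 * w) := by
          rw [← Real.exp_nat_mul, mul_assoc, ← Real.exp_add]; push_cast; ring_nf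
    have h6 : D ≤ Real.exp (7 * w) := hDw.trans (Real.exp_le_exp.2 (by linarith))
    rw [h1]
    have h7 : 7 * Real.exp (7 * w) ≤ Real.exp (7 * w) * 19 * Real.log 2 := by
      have := mul_le_mul_of_nonneg_left hlog2.le (Real.exp_pos (7 * w)).le
      linarith [Real.exp_pos (7 * w)]
    have h8 : Real.exp (7 * w) * 19 * Real.log 2 ≤
        Real.exp (y * Real.log 2 / 1000) * Real.log 2 := by
      gcongr
      refine le_trans ?_ (h3 ▸ h2)
      gcongr
    linarith
  obtain ⟨Ω, i1, i2, B, hB, hBf⟩ := one_round (ℓ := ℓ) (r := n) (N := N) (m := m) (b := b)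
    (by exact_mod_cast hℓ0) (by exact_mod_cast hb0) hK0 ht0 hκ0 hκK hpow hm
  refine ⟨δ / 2 * (Q ^ m)⁻¹, by positivity, ?_, Ω, i1, i2, B, fun ω => ?_, hBf⟩
  · calc (2 : ℝ) ^ (-((2 : ℝ) ^ y) ^ (1 / 1000 : ℝ))
        = Real.exp (-(((2 : ℝ) ^ y) ^ (1 / 1000 : ℝ) * Real.log 2)) := by
          rw [Real.rpow_def_of_pos (by norm_num)]; ring_nf
      _ ≤ Real.exp (-(2 * D + 5 * m ^ 2 * t⁻¹)) := Real.exp_le_exp.2 (by linarith)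
      _ = Real.exp (-D) * (Real.exp (-D) * (Real.exp (5 * m ^ 2 * t⁻¹))⁻¹) := by
          rw [← Real.exp_neg, ← Real.exp_add, ← Real.exp_add]; ring_nf
      _ ≤ δ * (δ / 2 * (Q ^ m)⁻¹) := by
          rw [hexpD]
          gcongr
          linarith
  · have h1 : ((B ω).card : ℝ) ≤ N + m * b := by exact_mod_cast hB ω
    have h2 : (m : ℝ) * b ≤ m * (t * ℓ / (2 * m)) := by gcongr
    have h3 : (m : ℝ) * (t * ℓ / (2 * m)) = t * ℓ / 2 := by field_simp
    linarith

end Parameters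

section Main

open Filter

lemma Attackable.mono {ℓ k : ℕ} {r : Fin k → ℕ} {δ ε η s δ' ε' η' s' : ℝ}
    (h : Attackable ℓ k r δ ε η s) (hδ : δ ≤ δ') (hε : ε ≤ ε') (hη : η' ≤ η) (hs : s ≤ s') :
    Attackable ℓ k r δ' ε' η' s' := by
  obtain ⟨Ω, i1, i2, B, hB, hBπ⟩ := h
  refine ⟨Ω, i1, i2, B, fun ω => (hB ω).trans hs, fun π hπ => ?_⟩
  refine hη.trans ((hBπ π (hδ.trans hπ)).trans (Finset.expect_le_expect fun ω _ => ?_))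
  by_cases h1 : 1 - ε ≤ val (B ω) k r π
  · rw [if_pos h1, if_pos (by linarith)]
  · rw [if_neg h1]
    split_ifs <;> norm_num

lemma exists_attackable : ∃ C : ℝ, 0 < C ∧ ∀ (k ℓ : ℕ) (x : ℝ) (r : Fin k → ℕ), x ≤ ℓ →
    (∀ i : ℕ, i ≤ k → C ≤ iterLog i x) →
    (∀ i : Fin k, (r i : ℝ) ≤ (iterLog (i.val + 1) x) ^ (99 / 100 : ℝ)) →
    Attackable ℓ k r (1 / 200 - 2 * x ^ (-(1 / 1000) : ℝ)) (1 / 200 - 2 * x ^ (-(1 / 1000) : ℝ))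
      ((2 : ℝ) ^ (-x ^ (1 / 1000 : ℝ))) ((1 / 200 - 2 * x ^ (-(1 / 1000) : ℝ)) * ℓ) := by
  have e1 : ∀ᶠ x : ℝ in atTop, 2 * x ^ (-(1 / 1000) : ℝ) < 1 / 200 := by
    have h := (tendsto_rpow_neg_atTop (show (0 : ℝ) < 1 / 1000 by norm_num)).eventually_lt_const
      (show (0 : ℝ) < 1 / 400 by norm_num)
    filter_upwards [h] with x hx
    linarith
  have e2 : ∀ᶠ y : ℝ in atTop, 2 * ((2 : ℝ) ^ y) ^ (-(1 / 1000) : ℝ) ≤ y ^ (-(1 / 1000) : ℝ) := by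
    have h := eventually_rpow_le
    filter_upwards [h, eventually_ge_atTop 1] with y hy hy1
    have hy0 : 0 < y := by linarith
    have h1 : ((2 : ℝ) ^ y) ^ (-(1 / 1000) : ℝ) = (Real.exp (y * Real.log 2 / 1000))⁻¹ := by
      rw [← Real.rpow_mul (by norm_num), Real.rpow_def_of_pos (by norm_num), ← Real.exp_neg]
      ring_nf
    have h2 : y ^ (1 / 1000 : ℝ) ≤ y ^ (996 / 1000 : ℝ) :=
      Real.rpow_le_rpow_of_exponent_le hy1 (by norm_num)
    have h3 := Real.add_one_le_exp (y * Real.log 2 / 1000)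
    have h4 : 0 < y ^ (1 / 1000 : ℝ) := Real.rpow_pos_of_pos hy0 _
    rw [h1, Real.rpow_neg hy0.le, ← div_eq_mul_inv, div_le_iff₀ (Real.exp_pos _),
      ← div_eq_inv_mul, le_div_iff₀ h4]
    linarith
  obtain ⟨C, hC⟩ := eventually_atTop.1 (e1.and (e2.and eventually_roundAttackable))
  refine ⟨max C 1, by positivity, fun k => ?_⟩
  induction k with
  | zero =>
    intro ℓ x r hx hlog _
    have hxC : max C 1 ≤ x := hlog 0 le_rfl
    have h1 := (hC x ((le_max_left _ _).trans hxC)).1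
    refine attackable_zero ℓ r (by linarith) (by linarith) ?_
      (mul_nonneg (by linarith) (Nat.cast_nonneg _))
    refine Real.rpow_le_one_of_one_le_of_nonpos (by norm_num) ?_
    exact neg_nonpos.2 (Real.rpow_nonneg (by linarith [le_max_right C 1]) _)
  | succ k ih =>
    intro ℓ x r hx hlog hr
    have hiter : ∀ i, iterLog (i + 1) x = iterLog i (Real.logb 2 x) := fun i => by
      simp [iterLog, Function.iterate_succ_apply]
    have hxC : max C 1 ≤ x := hlog 0 (Nat.zero_le _)
    have hyC : max C 1 ≤ Real.logb 2 x := hlog 1 (by omega)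
    set y := Real.logb 2 x with hy
    have hx0 : 0 < x := by linarith [le_max_right C 1]
    have hy1 : 1 ≤ y := (le_max_right C 1).trans hyC
    have hxy : (2 : ℝ) ^ y = x := Real.rpow_logb (by norm_num) (by norm_num) hx0
    have hyx : y ≤ x := by
      have h1 := one_add_mul_self_le_rpow_one_add (s := 1) (by norm_num) hy1
      norm_num at h1
      linarith
    obtain ⟨c1, c2, c3⟩ := hC y ((le_max_left _ _).trans hyC)
    have IH := ih ℓ y (fun i => r i.succ) (hyx.trans hx)
      (fun i hi => by rw [← hiter]; exact hlog (i + 1) (by omega))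
      (fun i => by rw [← hiter]; exact hr i.succ)
    obtain ⟨η₁, hη₁, hη, hround⟩ := c3 ℓ (r 0) (by rw [hxy]; exact hx) (by simpa [show iterLog 1 x = y from rfl] using hr 0)
    have ht0 : 0 ≤ y ^ (-(1 / 1000) : ℝ) := Real.rpow_nonneg (by linarith) _
    rw [hxy] at hη c2
    refine (IH.cons hround (by linarith) (by positivity) ht0 (by linarith) (by linarith) ht0
      hη₁).mono (by linarith) (by linarith) hη ?_
    rw [← add_mul]
    exact mul_le_mul_of_nonneg_right (by linarith) (Nat.cast_nonneg _)

end Main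

end CoinFlip

theorem mainTheorem4 :
    ∃ C : ℝ, 0 < C ∧
      ∀ (k ℓ : ℕ), 1 ≤ k →
        (∀ i : ℕ, i ≤ k → C ≤ CoinFlip.iterLog i (ℓ : ℝ)) →
        ∀ (r : Fin k → ℕ),
          (∀ i : Fin k, (r i : ℝ) ≤ (CoinFlip.iterLog (i.val + 1) (ℓ : ℝ)) ^ (99 / 100 : ℝ)) →
          ∀ (π : CoinFlip.Protocol ℓ k r),
            1 / 100 ≤ CoinFlip.prob π →
            ∃ B : Finset (Fin ℓ),
              (B.card : ℝ) ≤ (1 / 100) * (ℓ : ℝ) ∧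
              ∃ σ : CoinFlip.Adversary ℓ k r B,
                99 / 100 ≤ CoinFlip.prob (fun x : CoinFlip.GoodCoins ℓ k r B =>
                  π (CoinFlip.play σ x)) := by
  obtain ⟨C, hC, H⟩ := CoinFlip.exists_attackable
  refine ⟨C, hC, fun k ℓ _ hlog r hr π hπ => ?_⟩
  obtain ⟨Ω, _, _, B, hB, hBπ⟩ := H k ℓ ℓ r le_rfl hlog hr
  have ht : 0 ≤ (ℓ : ℝ) ^ (-(1 / 1000) : ℝ) := Real.rpow_nonneg (Nat.cast_nonneg _) _
  have h := hBπ π (by linarith)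
  have hpos : 0 < (2 : ℝ) ^ (-(ℓ : ℝ) ^ (1 / 1000 : ℝ)) := Real.rpow_pos_of_pos (by norm_num) _
  obtain ⟨ω, hω⟩ : ∃ ω, 1 - (1 / 200 - 2 * (ℓ : ℝ) ^ (-(1 / 1000) : ℝ)) ≤
      CoinFlip.val (B ω) k r π := by
    by_contra! hcon
    simp only [not_le.2 (hcon _), if_false, Finset.expect_const_zero] at h
    linarith
  obtain ⟨σ, hσ⟩ := CoinFlip.exists_adversary (B ω) π
  refine ⟨B ω, (hB ω).trans ?_, σ, ?_⟩
  · exact mul_le_mul_of_nonneg_right (by linarith) (Nat.cast_nonneg _)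
  · rw [hσ]
    linarith
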